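/- Let $(G,d)$ be a complete metric group (a topological group, with identity $e$, whose topology is given by the complete metric $d$) whose left translations $\tau_q(x)=q\cdot x$ are isometries, and assume that $G$ is doubling: for some $K\in\mathbb{N}$ every closed ball $B(x,\rho)$, $\rho>0$, is covered by $K$ closed balls of radius $\rho/2$. Assume that $G$ carries dilations $\delta_r:G\to G$, $r>0$, i.e. continuous group homomorphisms with $\delta_1=\mathrm{id}$, $\delta_{rt}=\delta_r\circ\delta_t$ and $d(\delta_r(x),\delta_r(y))=r\,d(x,y)$. Let $N\ge 2$, $q_1,\dots,q_N\in G$, $r_1,\dots,r_N\in(0,1)$, and let $\mathcal{S}=\{S_1,\dots,S_N\}$ with $S_i=\tau_{q_i}\circ\delta_{r_i}$. Let $C$ be its self-similar set, i.e. the unique non-empty compact set with $C=\bigcup_{i}S_i(C)$, and let $s$ be its similarity dimension, $\sum_{i=1}^N r_i^s=1$. Suppose that $\mathcal{S}$ satisfies the open set condition (OSC): there is a non-empty open set $O$ with $S_i(O)\subset O$ for all $i$ and $S_i(O)\cap S_j(O)=\emptyset$ for $i\ne j$. If moreover $O\cap C\neq\emptyset$, we say that $\mathcal{S}$ satisfies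 the strong OSC for $O$. Put $\mu=\mathcal{H}^s(C)^{-1}\,\mathcal{H}^s\lfloor C$, where $\mathcal{H}^s$ is the $s$-dimensional Hausdorff measure of $(G,d)$. For a finite word $w=(w_1,\dots,w_n)$ in $\{1,\dots,N\}$ write $S_w=S_{w_1}\circ\dots\circ S_{w_n}$ and $C_w=S_w(C)$. Let $k$ be an $s$-homogeneous kernel, i.e. $k(x,y)=\Omega(x^{-1}\cdot y)/d(x,y)^s$ for $x\ne y$, where $\Omega:G\setminus\{e\}\to\mathbb{R}$ is continuous, not identically zero, and satisfies $\Omega(\delta_r(x))=\Omega(x)$ for all $x\in G\setminus\{e\}$, $r>0$. Let $$T^*(1)(x)=\sup_{\varepsilon>0}\left|\int_{G\setminus B(x,\varepsilon)}k(x,y)\,d\mu(y)\right|,$$ where $B(x,\varepsilon)$ is the closed ball. Suppose that there are a finite word $w$, a point $x_w\in C$ with $S_w(x_w)=x_w$, and an open set $O$ for which $\mathcal{S}$ satisfies the strong OSC such that $x_w\in O$ and $$\int_{C\setminus C_w}k(x_w,y)\,d\mu(y)\ne 0.$$ Then $T^*(1)(x)=\infty$ for $\mu$-a.e. $x$. 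-/

import Mathlib

open MeasureTheory Metric

noncomputable section

/-- A doubling metric space: every closed ball is covered by a fixed number of closed balls of
half its radius. -/
def IsDoublingMetric (X : Type*) [MetricSpace X] : Prop :=
  ∃ K : ℕ, ∀ (x : X) (r : ℝ), 0 < r →
    ∃ c : Fin K → X, closedBall x r ⊆ ⋃ i, closedBall (c i) (r / 2)

/-- A family of dilations `δ r`, `r > 0`, of a metric group
(the maps `δ r` with `r ≤ 0` play no role). -/
structure IsDilationFamily {G : Type*} [MetricSpace G] [Group G] (δ : ℝ → G →* G) : Prop where
  continuous : ∀ r : ℝ, 0 < r → Continuous (δ r)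
  one : δ 1 = MonoidHom.id G
  dist_map : ∀ r : ℝ, 0 < r → ∀ x y : G, dist (δ r x) (δ r y) = r * dist x y
  mul : ∀ r t : ℝ, 0 < r → 0 < t → δ (r * t) = (δ r).comp (δ t)

/-- The rotation-free IFS `S i = τ_{q i} ∘ δ_{r i}`. -/
def rotationFreeIFS {G : Type*} [Group G] {N : ℕ} (δ : ℝ → G →* G)
    (q : Fin N → G) (r : Fin N → ℝ) : Fin N → G → G :=
  fun i x => q i * δ (r i) x

/-- `S_w = S_{w₁} ∘ ⋯ ∘ S_{wₙ}` for a finite word `w`; the empty word gives the identity. -/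
def wordMap {G : Type*} {N : ℕ} (S : Fin N → G → G) : List (Fin N) → G → G
  | [] => id
  | i :: w => S i ∘ wordMap S w

/-- `C` is the self-similar set of `S`: the (unique) non-empty compact set with
`C = ⋃ i, S i (C)`. -/
structure IsSelfSimilarSet {G : Type*} [MetricSpace G] {N : ℕ} (S : Fin N → G → G)
    (C : Set G) : Prop where
  isCompact : IsCompact C
  nonempty : C.Nonempty
  eq_iUnion : C = ⋃ i, S i '' C

/-- `O` is a non-empty open set witnessing the open set condition for `S`. -/
structure IsOSCSet {G : Type*} [MetricSpace G] {N : ℕ} (S : Fin N → G → G)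
    (O : Set G) : Prop where
  isOpen : IsOpen O
  nonempty : O.Nonempty
  image_subset : ∀ i, S i '' O ⊆ O
  disjoint : ∀ i j, i ≠ j → Disjoint (S i '' O) (S j '' O)

/-- The open set condition. -/
def SatisfiesOSC {G : Type*} [MetricSpace G] {N : ℕ} (S : Fin N → G → G) : Prop :=
  ∃ O : Set G, IsOSCSet S O

/-- `O` is an open set witnessing the strong open set condition for `S`, whose self-similar set
is `C`. -/
def IsSOSCSet {G : Type*} [MetricSpace G] {N : ℕ} (S : Fin N → G → G) (C O : Set G) : Prop :=
  IsOSCSet S O ∧ (O ∩ C).Nonempty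

/-- `x` is a periodic point of `S` belonging to the word `w`. -/
def IsPeriodicPoint {G : Type*} {N : ℕ} (S : Fin N → G → G) (C : Set G)
    (w : List (Fin N)) (x : G) : Prop :=
  x ∈ C ∧ wordMap S w x = x

/-- `s`-homogeneous kernels: `k x y = Ω (x⁻¹ y) / d(x,y)^s` off the diagonal, with `Ω` continuous,
homogeneous of degree zero and not identically zero on `G ∖ {1}`. -/
def IsHomogeneousKernel {G : Type*} [MetricSpace G] [Group G] (δ : ℝ → G →* G) (s : ℝ)
    (k : G → G → ℝ) : Prop :=
  ∃ Ω : G → ℝ, ContinuousOn Ω {1}ᶜ ∧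
    (∀ x : G, x ≠ 1 → ∀ r : ℝ, 0 < r → Ω (δ r x) = Ω x) ∧
    (∃ x : G, x ≠ 1 ∧ Ω x ≠ 0) ∧
    ∀ x y : G, x ≠ y → k x y = Ω (x⁻¹ * y) / dist x y ^ s

/-- The normalized restriction `H^s(C)⁻¹ H^s⌊C` of the `s`-dimensional Hausdorff measure. -/
def normalizedHausdorff {G : Type*} [MetricSpace G] [MeasurableSpace G] [BorelSpace G]
    (s : ℝ) (C : Set G) : Measure G :=
  (μH[s] C)⁻¹ • (μH[s]).restrict C

/-- The truncated singular integral `T_ε f (x) = ∫_{G ∖ B(x,ε)} k(x,y) f(y) dμ(y)`. -/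
def truncatedSI {G : Type*} [MetricSpace G] [MeasurableSpace G] (μ : Measure G)
    (k : G → G → ℝ) (ε : ℝ) (f : G → ℝ) (x : G) : ℝ :=
  ∫ y in (closedBall x ε)ᶜ, k x y * f y ∂μ

/-- The maximal singular integral `T^* f (x) = sup_{ε > 0} |T_ε f (x)| ∈ [0, ∞]`. -/
def maximalSI {G : Type*} [MetricSpace G] [MeasurableSpace G] (μ : Measure G)
    (k : G → G → ℝ) (f : G → ℝ) (x : G) : ENNReal :=
  ⨆ (ε : ℝ) (_ : 0 < ε), ENNReal.ofReal |truncatedSI μ k ε f x|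

end

/-! The kernel has degree `-s` and `μH[s]` scales with degree `s`, so the singular integral is
invariant under the maps `S_v`. Let `I ≠ 0` be the integral of `k x_w` off `C_w`. Invariance at the
fixed point gives the integral `m * I` off the `m`-fold iterate of the period
(`exists_setIntegral_diff_eq_nat_mul`), and by continuity it stays within `1` of `m * I` for base
points near `x_w`.

Near `x_w` the set removed can be replaced by a ball, and a difference of two truncations sees the
same integral up to an error independent of `m`; applying any `S_v` changes nothing
(`abs_setIntegral_diff_le_truncatedSI`). This needs small balls about `S_v x` to meet `C` only
inside `C_v`, which the open set condition supplies once `x_w ∈ O` (`inter_wordMap_image_subset`).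

Almost every point of `C` lies in some `S_v (C_u)` with `C_u` as close to `x_w` as desired
(`hausdorffMeasure_diff_iUnion_wordMap_image`). Hence `2 * T^*(1) ≥ m * |I| - const` almost
everywhere, for every `m`. -/

/-! ### Doubling and properness. -/

theorem IsDoublingMetric.totallyBounded_closedBall {X : Type*} [MetricSpace X]
    (h : IsDoublingMetric X) (x : X) {R : ℝ} (hR : 0 < R) : TotallyBounded (closedBall x R) := by
  obtain ⟨K, hK⟩ := h
  have key : ∀ n : ℕ, ∃ t : Set X, t.Finite ∧
      closedBall x R ⊆ ⋃ y ∈ t, closedBall y (R / 2 ^ n) := by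
    intro n
    induction n with
    | zero => exact ⟨{x}, Set.finite_singleton x, by simp⟩
    | succ n ih =>
      obtain ⟨t, ht, hsub⟩ := ih
      choose c hc using fun y => hK y (R / 2 ^ n) (by positivity)
      refine ⟨⋃ y ∈ t, Set.range (c y), ht.biUnion fun y _ => Set.finite_range _, ?_⟩
      intro z hz
      obtain ⟨y, hy, hzy⟩ := Set.mem_iUnion₂.1 (hsub hz)
      obtain ⟨i, hi⟩ := Set.mem_iUnion.1 (hc y hzy)
      refine Set.mem_iUnion₂.2 ⟨c y i, Set.mem_iUnion₂.2 ⟨y, hy, i, rfl⟩, ?_⟩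
      rwa [pow_succ, ← div_div]
  refine Metric.totallyBounded_iff.2 fun ε hε => ?_
  obtain ⟨n, hn⟩ := exists_pow_lt_of_lt_one (div_pos hε hR) (by norm_num : (1 / 2 : ℝ) < 1)
  obtain ⟨t, ht, hsub⟩ := key n
  refine ⟨t, ht, hsub.trans (Set.iUnion₂_mono fun y _ => closedBall_subset_ball ?_)⟩
  rw [lt_div_iff₀ hR] at hn
  calc R / 2 ^ n = (1 / 2) ^ n * R := by rw [div_pow, one_pow]; ring
    _ < ε := hn

theorem IsDoublingMetric.properSpace {X : Type*} [MetricSpace X] [CompleteSpace X]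
    (h : IsDoublingMetric X) : ProperSpace X :=
  .of_isCompact_closedBall_of_le 1 fun x _ hR =>
    (h.totallyBounded_closedBall x (zero_lt_one.trans_le hR)).isCompact_of_isClosed
      isClosed_closedBall

/-! ### Homotheties and the scaling of Hausdorff measure. -/

/-- `f` is a left translate of the dilation `δ ρ` with `ρ > 0`. -/
structure IsHomothety {G : Type*} [Group G] (δ : ℝ → G →* G) (ρ : ℝ) (f : G → G) : Prop where
  pos : 0 < ρ
  exists_eq : ∃ q : G, ∀ x, f x = q * δ ρ x

theorem IsHomothety.inv_mul {G : Type*} [Group G] {δ : ℝ → G →* G} {ρ : ℝ} {f : G → G}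
    (hf : IsHomothety δ ρ f) (x y : G) :
    (f x)⁻¹ * f y = δ ρ (x⁻¹ * y) := by
  obtain ⟨-, a, ha⟩ := hf
  simp [ha, mul_assoc]

theorem setIntegral_normalizedHausdorff {G : Type*} [MetricSpace G] [MeasurableSpace G] [BorelSpace G]
    {s : ℝ} {C A : Set G} (hA : A ⊆ C) (h : G → ℝ) :
    ∫ y in A, h y ∂normalizedHausdorff s C = (μH[s] C)⁻¹.toReal * ∫ y in A, h y ∂μH[s] := by
  rw [normalizedHausdorff, Measure.restrict_smul, integral_smul_measure, smul_eq_mul,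
    Measure.restrict_restrict_of_subset hA]

section Homothety

variable {G : Type*} [MetricSpace G] [Group G] {δ : ℝ → G →* G} {ρ σ : ℝ} {f g : G → G}

theorem IsHomothety.id (hδ : IsDilationFamily δ) : IsHomothety δ 1 (id : G → G) :=
  ⟨one_pos, 1, fun x => by simp [hδ.one]⟩

theorem IsHomothety.comp (hδ : IsDilationFamily δ) (hf : IsHomothety δ ρ f)
    (hg : IsHomothety δ σ g) : IsHomothety δ (ρ * σ) (f ∘ g) := by
  obtain ⟨hρ, a, ha⟩ := hf
  obtain ⟨hσ, b, hb⟩ := hg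
  exact ⟨mul_pos hρ hσ, a * δ ρ b, fun x => by simp [ha, hb, hδ.mul ρ σ hρ hσ, mul_assoc]⟩

theorem IsHomothety.exists_inverse (hδ : IsDilationFamily δ) (hf : IsHomothety δ ρ f) :
    ∃ g, IsHomothety δ ρ⁻¹ g ∧ Function.LeftInverse g f ∧ Function.RightInverse g f := by
  obtain ⟨hρ, a, ha⟩ := hf
  have h1 : ∀ x, δ ρ (δ ρ⁻¹ x) = x := fun x => by
    have := hδ.mul ρ ρ⁻¹ hρ (inv_pos.2 hρ)
    rw [mul_inv_cancel₀ hρ.ne', hδ.one] at this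
    exact (DFunLike.congr_fun this x).symm
  have h2 : ∀ x, δ ρ⁻¹ (δ ρ x) = x := fun x => by
    have := hδ.mul ρ⁻¹ ρ (inv_pos.2 hρ) hρ
    rw [inv_mul_cancel₀ hρ.ne', hδ.one] at this
    exact (DFunLike.congr_fun this x).symm
  exact ⟨fun x => δ ρ⁻¹ (a⁻¹ * x), ⟨inv_pos.2 hρ, δ ρ⁻¹ a⁻¹, fun x => by simp⟩,
    fun x => by simp [ha, h2], fun x => by simp only [ha, h1]; simp⟩

theorem IsHomothety.bijective (hδ : IsDilationFamily δ) (hf : IsHomothety δ ρ f) :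
    Function.Bijective f := by
  obtain ⟨g, -, h1, h2⟩ := hf.exists_inverse hδ
  exact ⟨h1.injective, h2.surjective⟩

variable [IsIsometricSMul G G]

theorem IsHomothety.dist_map (hδ : IsDilationFamily δ) (hf : IsHomothety δ ρ f) (x y : G) :
    dist (f x) (f y) = ρ * dist x y := by
  obtain ⟨hρ, a, ha⟩ := hf
  rw [ha, ha, dist_mul_left, hδ.dist_map ρ hρ]

theorem IsHomothety.lipschitzWith (hδ : IsDilationFamily δ) (hf : IsHomothety δ ρ f) :
    LipschitzWith ρ.toNNReal f :=
  LipschitzWith.of_dist_le_mul fun x y => by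
    rw [hf.dist_map hδ, Real.coe_toNNReal _ hf.pos.le]

theorem IsHomothety.isOpen_image (hδ : IsDilationFamily δ) (hf : IsHomothety δ ρ f) {U : Set G}
    (hU : IsOpen U) : IsOpen (f '' U) := by
  obtain ⟨g, hg, h1, h2⟩ := hf.exists_inverse hδ
  rw [Set.image_eq_preimage_of_inverse h1 h2]
  exact hU.preimage (hg.lipschitzWith hδ).continuous

theorem IsHomothety.map_mem_closedBall (hδ : IsDilationFamily δ) (hf : IsHomothety δ ρ f)
    {x y : G} {R : ℝ} : f y ∈ closedBall (f x) (ρ * R) ↔ y ∈ closedBall x R := by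
  rw [mem_closedBall, mem_closedBall, hf.dist_map hδ, mul_le_mul_iff_right₀ hf.pos]

theorem IsHomothety.image_closedBall (hδ : IsDilationFamily δ) (hf : IsHomothety δ ρ f)
    (x : G) (R : ℝ) : f '' closedBall x R = closedBall (f x) (ρ * R) := by
  ext z
  obtain ⟨y, rfl⟩ := (hf.bijective hδ).2 z
  rw [(hf.bijective hδ).1.mem_set_image, hf.map_mem_closedBall hδ]

variable [MeasurableSpace G] [BorelSpace G] {s : ℝ}

theorem IsHomothety.measurableEmbedding (hδ : IsDilationFamily δ) (hf : IsHomothety δ ρ f) :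
    MeasurableEmbedding f := by
  obtain ⟨g, hg, h1, h2⟩ := hf.exists_inverse hδ
  exact (MeasurableEquiv.mk ⟨f, g, h1, h2⟩ (hf.lipschitzWith hδ).continuous.measurable
    (hg.lipschitzWith hδ).continuous.measurable).measurableEmbedding

theorem IsHomothety.hausdorffMeasure_image_le (hδ : IsDilationFamily δ)
    (hf : IsHomothety δ ρ f) (hs : 0 ≤ s) (A : Set G) :
    μH[s] (f '' A) ≤ ENNReal.ofReal (ρ ^ s) * μH[s] A := by
  rw [← ENNReal.ofReal_rpow_of_pos hf.pos]
  exact (hf.lipschitzWith hδ).hausdorffMeasure_image_le hs A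

theorem IsHomothety.hausdorffMeasure_image (hδ : IsDilationFamily δ)
    (hf : IsHomothety δ ρ f) (hs : 0 ≤ s) (A : Set G) :
    μH[s] (f '' A) = ENNReal.ofReal (ρ ^ s) * μH[s] A := by
  refine (hf.hausdorffMeasure_image_le hδ hs A).antisymm ?_
  obtain ⟨g, hg, h1, h2⟩ := hf.exists_inverse hδ
  have h := hg.hausdorffMeasure_image_le hδ hs (f '' A)
  rw [h1.image_image] at h
  refine (mul_le_mul_right h _).trans ?_
  have hρ := hf.pos
  rw [← mul_assoc, ← ENNReal.ofReal_mul (by positivity), ← Real.mul_rpow hρ.le (by positivity),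
    mul_inv_cancel₀ hρ.ne']
  simp

theorem IsHomothety.map_hausdorffMeasure (hδ : IsDilationFamily δ)
    (hf : IsHomothety δ ρ f) (hs : 0 ≤ s) :
    (μH[s] : Measure G).map f = ENNReal.ofReal (ρ⁻¹ ^ s) • μH[s] := by
  obtain ⟨g, hg, h1, h2⟩ := hf.exists_inverse hδ
  ext A -
  rw [(hf.measurableEmbedding hδ).map_apply, ← Set.image_eq_preimage_of_inverse h2 h1,
    hg.hausdorffMeasure_image hδ hs, Measure.smul_apply, smul_eq_mul]

theorem IsHomothety.setIntegral_image_hausdorffMeasure (hδ : IsDilationFamily δ)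
    (hf : IsHomothety δ ρ f) (hs : 0 ≤ s) (h : G → ℝ) (B : Set G) :
    ∫ y in f '' B, h y ∂μH[s] = ρ ^ s * ∫ y in B, h (f y) ∂μH[s] := by
  have hρ := hf.pos
  have key := (hf.measurableEmbedding hδ).setIntegral_map (μ := μH[s]) h (f '' B)
  rw [hf.map_hausdorffMeasure hδ hs, Measure.restrict_smul, integral_smul_measure,
    Set.preimage_image_eq _ (hf.bijective hδ).1, ENNReal.toReal_ofReal (by positivity),
    smul_eq_mul] at key
  rw [← key, ← mul_assoc, ← Real.mul_rpow hρ.le (by positivity), mul_inv_cancel₀ hρ.ne',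
    Real.one_rpow, one_mul]

/-- Since `B` and its image both lie in `C`, the restriction to `C` is invisible and the scaling of
`μH[s]` carries over. -/
theorem IsHomothety.setIntegral_image (hδ : IsDilationFamily δ)
    (hf : IsHomothety δ ρ f) (hs : 0 ≤ s) (h : G → ℝ) {B C : Set G} (hB : B ⊆ C)
    (hfB : f '' B ⊆ C) :
    ∫ y in f '' B, h y ∂normalizedHausdorff s C
      = ρ ^ s * ∫ y in B, h (f y) ∂normalizedHausdorff s C := by
  rw [setIntegral_normalizedHausdorff hfB, setIntegral_normalizedHausdorff hB,
    hf.setIntegral_image_hausdorffMeasure hδ hs]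
  ring

theorem IsHomothety.normalizedHausdorff_image (hδ : IsDilationFamily δ)
    (hf : IsHomothety δ ρ f) (hs : 0 ≤ s) {B C : Set G} (hB : B ⊆ C) (hfB : f '' B ⊆ C) :
    (normalizedHausdorff s C).real (f '' B) = ρ ^ s * (normalizedHausdorff s C).real B := by
  simpa using hf.setIntegral_image hδ hs (fun _ => 1) hB hfB

end Homothety

/-! ### Homogeneous kernels: scaling, size and continuity. -/

theorem IsHomogeneousKernel.continuousOn {G : Type*} [MetricSpace G] [Group G]
    [IsTopologicalGroup G] {δ : ℝ → G →* G} {s : ℝ} {k : G → G → ℝ}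
    (hk : IsHomogeneousKernel δ s k) :
    ContinuousOn (fun p : G × G => k p.1 p.2) {p | p.1 ≠ p.2} := by
  obtain ⟨Ω, hc, -, -, hk⟩ := hk
  refine ContinuousOn.congr (f := fun p : G × G => Ω (p.1⁻¹ * p.2) / dist p.1 p.2 ^ s) ?_
    fun p hp => hk _ _ hp
  refine ContinuousOn.div (hc.comp (by fun_prop) fun p hp => ?_) ?_ fun p hp => ?_
  · simpa [inv_mul_eq_one] using hp
  · exact ContinuousOn.rpow_const (by fun_prop) fun p hp => .inl (dist_pos.2 hp).ne'
  · exact (Real.rpow_pos_of_pos (dist_pos.2 hp) s).ne'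

section Kernel

variable {G : Type*} [MetricSpace G] [Group G] [IsIsometricSMul G G] {δ : ℝ → G →* G}
  {s : ℝ} {k : G → G → ℝ}

theorem dist_one_inv_mul (x y : G) : dist 1 (x⁻¹ * y) = dist x y := by
  rw [← dist_mul_left x, mul_one, mul_inv_cancel_left]

theorem IsHomogeneousKernel.map (hδ : IsDilationFamily δ) (hk : IsHomogeneousKernel δ s k)
    {ρ : ℝ} {f : G → G} (hf : IsHomothety δ ρ f) {x y : G} (hxy : x ≠ y) :
    ρ ^ s * k (f x) (f y) = k x y := by
  obtain ⟨Ω, -, hΩ, -, hk⟩ := hk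
  have hρ := hf.pos
  have : 0 < dist x y := dist_pos.2 hxy
  rw [hk _ _ hxy, hk _ _ ((hf.bijective hδ).1.ne hxy), hf.dist_map hδ, hf.inv_mul,
    hΩ _ (by rwa [Ne, inv_mul_eq_one]) _ hρ, Real.mul_rpow hρ.le this.le]
  field_simp

/-- Dilating `x⁻¹ * y` to the unit sphere does not change `Ω`, and that sphere is compact because a
complete doubling space is proper. -/
theorem IsHomogeneousKernel.exists_bound [CompleteSpace G] (hG : IsDoublingMetric G)
    (hδ : IsDilationFamily δ) (hk : IsHomogeneousKernel δ s k) :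
    ∃ M : ℝ, 0 ≤ M ∧ ∀ x y, x ≠ y → |k x y| ≤ M / dist x y ^ s := by
  have := hG.properSpace
  obtain ⟨Ω, hc, hΩ, -, hk⟩ := hk
  obtain ⟨M, hM⟩ := (isCompact_sphere (1 : G) 1).exists_bound_of_continuousOn
    (hc.mono fun z hz => ne_of_mem_sphere hz one_ne_zero)
  refine ⟨max M 0, le_max_right _ _, fun x y hxy => ?_⟩
  have hd : 0 < dist x y := dist_pos.2 hxy
  have hz : x⁻¹ * y ≠ 1 := by rwa [Ne, inv_mul_eq_one]
  have hmem : δ (dist x y)⁻¹ (x⁻¹ * y) ∈ sphere (1 : G) 1 := by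
    rw [mem_sphere', ← map_one (δ (dist x y)⁻¹), hδ.dist_map _ (inv_pos.2 hd), dist_one_inv_mul,
      inv_mul_cancel₀ hd.ne']
  rw [hk x y hxy, abs_div, abs_of_pos (Real.rpow_pos_of_pos hd s)]
  gcongr
  rw [← hΩ _ hz _ (inv_pos.2 hd)]
  exact (hM _ hmem).trans (le_max_left _ _)

end Kernel

/-- Holds also when `μH[s] C` is `0` or `⊤`, because `a⁻¹ * a ≤ 1` in `ENNReal`. -/
instance isFiniteMeasure_normalizedHausdorff {G : Type*} [MetricSpace G] [MeasurableSpace G]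
    [BorelSpace G] (s : ℝ) (C : Set G) : IsFiniteMeasure (normalizedHausdorff s C) :=
  ⟨by
    rw [normalizedHausdorff, Measure.smul_apply, Measure.restrict_apply_univ, smul_eq_mul]
    exact (ENNReal.inv_mul_le_one _).trans_lt ENNReal.one_lt_top⟩

theorem ae_mem_normalizedHausdorff {G : Type*} [MetricSpace G] [MeasurableSpace G] [BorelSpace G]
    {s : ℝ} {C : Set G} (hC : MeasurableSet C) : ∀ᵐ x ∂normalizedHausdorff s C, x ∈ C :=
  Measure.ae_smul_measure (ae_restrict_mem hC) _

theorem abs_le_div_rpow_of_le_dist {G : Type*} [MetricSpace G] {s M ε : ℝ} {k : G → G → ℝ}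
    {x : G} (hs : 0 ≤ s) (hM : 0 ≤ M)
    (hkM : ∀ x y, x ≠ y → |k x y| ≤ M / dist x y ^ s) (hε : 0 < ε) {y : G} (h : ε ≤ dist x y) :
    |k x y| ≤ M / ε ^ s := by
  refine (hkM x y (dist_pos.1 (hε.trans_le h))).trans ?_
  gcongr

theorem abs_setIntegral_kernel_le {G : Type*} [MetricSpace G] [MeasurableSpace G] {s M ε : ℝ}
    {k : G → G → ℝ} {μ : Measure G} [IsFiniteMeasure μ] {A : Set G} {x : G} (hs : 0 ≤ s) (hM : 0 ≤ M)
    (hkM : ∀ x y, x ≠ y → |k x y| ≤ M / dist x y ^ s) (hε : 0 < ε)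
    (hd : ∀ y ∈ A, ε ≤ dist x y) : |∫ y in A, k x y ∂μ| ≤ M / ε ^ s * μ.real A :=
  norm_setIntegral_le_of_norm_le_const (f := k x) (measure_lt_top _ _) fun y hy =>
    abs_le_div_rpow_of_le_dist hs hM hkM hε (hd y hy)

section KernelIntegral

variable {G : Type*} [MetricSpace G] [Group G] [IsTopologicalGroup G] [MeasurableSpace G]
  [BorelSpace G] {δ : ℝ → G →* G} {s M ε : ℝ} {k : G → G → ℝ} {μ : Measure G}
  {A : Set G} {x : G}

theorem IsHomogeneousKernel.aestronglyMeasurable (hk : IsHomogeneousKernel δ s k)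
    (hA : MeasurableSet A) (hx : x ∉ A) : AEStronglyMeasurable (k x) (μ.restrict A) := by
  refine ContinuousOn.aestronglyMeasurable (hk.continuousOn.comp (f := fun y => (x, y))
    (by fun_prop) fun y hy => ?_) hA
  exact fun h : x = y => hx (h ▸ hy)

variable [IsFiniteMeasure μ]

theorem IsHomogeneousKernel.integrableOn (hk : IsHomogeneousKernel δ s k) (hs : 0 ≤ s)
    (hM : 0 ≤ M) (hkM : ∀ x y, x ≠ y → |k x y| ≤ M / dist x y ^ s) (hε : 0 < ε)
    (hA : MeasurableSet A) (hd : ∀ y ∈ A, ε ≤ dist x y) : IntegrableOn (k x) A μ := by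
  refine Integrable.of_bound (C := M / ε ^ s)
    (hk.aestronglyMeasurable hA fun hx => ?_) ?_
  · have := hd x hx
    rw [dist_self] at this
    exact hε.not_ge this
  · filter_upwards [ae_restrict_mem hA] with y hy
    exact abs_le_div_rpow_of_le_dist hs hM hkM hε (hd y hy)

/-- Dominated convergence: base points within `ε / 2` of `x` keep distance `ε / 2` from `A`, which
bounds the kernel by a constant. -/
theorem IsHomogeneousKernel.continuousAt_setIntegral (hk : IsHomogeneousKernel δ s k)
    (hs : 0 ≤ s) (hM : 0 ≤ M) (hkM : ∀ x y, x ≠ y → |k x y| ≤ M / dist x y ^ s) (hε : 0 < ε)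
    (hA : MeasurableSet A) (hd : ∀ y ∈ A, ε ≤ dist x y) :
    ContinuousAt (fun x' => ∫ y in A, k x' y ∂μ) x := by
  have hnear : ∀ x' ∈ ball x (ε / 2), ∀ y ∈ A, ε / 2 ≤ dist x' y := fun x' hx' y hy => by
    have h1 := hd y hy
    have h2 := dist_triangle x x' y
    rw [mem_ball'] at hx'
    linarith
  have hball := ball_mem_nhds x (half_pos hε)
  refine continuousAt_of_dominated (bound := fun _ => M / (ε / 2) ^ s) ?_ ?_
    (integrable_const _) ?_
  · filter_upwards [hball] with x' hx'
    refine hk.aestronglyMeasurable hA fun hmem => ?_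
    have := hnear x' hx' x' hmem
    rw [dist_self] at this
    linarith
  · filter_upwards [hball] with x' hx'
    filter_upwards [ae_restrict_mem hA] with y hy
    exact abs_le_div_rpow_of_le_dist hs hM hkM (half_pos hε) (hnear x' hx' y hy)
  · filter_upwards [ae_restrict_mem hA] with y hy
    have hxy : x ≠ y := dist_pos.1 (hε.trans_le (hd y hy))
    have hopen : IsOpen {p : G × G | p.1 ≠ p.2} := isOpen_ne_fun continuous_fst continuous_snd
    exact (hk.continuousOn.continuousAt (hopen.mem_nhds hxy)).comp (f := fun x' => (x', y))
      (by fun_prop)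

end KernelIntegral

/-! ### Cylinders, the open set condition and null sets. -/

section SelfSimilar

variable {G : Type*} {N : ℕ} {C O : Set G}

theorem wordMap_append (S : Fin N → G → G) (u v : List (Fin N)) :
    wordMap S (u ++ v) = wordMap S u ∘ wordMap S v := by
  induction u with
  | nil => rfl
  | cons i u ih => rw [List.cons_append, wordMap, ih, wordMap, Function.comp_assoc]

theorem isHomothety_rotationFreeIFS {G : Type*} [Group G] {N : ℕ} {δ : ℝ → G →* G}
    {q : Fin N → G} {r : Fin N → ℝ} (hr : ∀ i, r i ∈ Set.Ioo (0 : ℝ) 1) (i : Fin N) :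
    IsHomothety δ (r i) (rotationFreeIFS δ q r i) :=
  ⟨(hr i).1, q i, fun _ => rfl⟩

variable [MetricSpace G]

theorem IsSelfSimilarSet.image_subset {S : Fin N → G → G} (hC : IsSelfSimilarSet S C)
    (i : Fin N) : S i '' C ⊆ C := by
  conv_rhs => rw [hC.eq_iUnion]
  exact Set.subset_iUnion (fun i => S i '' C) i

theorem IsSelfSimilarSet.wordMap_image_subset {S : Fin N → G → G} (hC : IsSelfSimilarSet S C)
    (w : List (Fin N)) : wordMap S w '' C ⊆ C := by
  induction w with
  | nil => simp [wordMap]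
  | cons i w ih =>
    rw [wordMap, Set.image_comp]
    exact (Set.image_mono ih).trans (hC.image_subset i)

theorem IsOSCSet.wordMap_image_subset {S : Fin N → G → G} (hO : IsOSCSet S O)
    (w : List (Fin N)) : wordMap S w '' O ⊆ O := by
  induction w with
  | nil => simp [wordMap]
  | cons i w ih =>
    rw [wordMap, Set.image_comp]
    exact (Set.image_mono ih).trans (hO.image_subset i)

theorem IsSelfSimilarSet.exists_eq {S : Fin N → G → G} (hC : IsSelfSimilarSet S C) {x : G}
    (hx : x ∈ C) : ∃ i, ∃ y ∈ C, S i y = x := by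
  rw [hC.eq_iUnion] at hx
  exact Set.mem_iUnion.1 hx

variable [Group G] {δ : ℝ → G →* G} {q : Fin N → G} {r : Fin N → ℝ}

theorem isHomothety_wordMap (hδ : IsDilationFamily δ) (hr : ∀ i, r i ∈ Set.Ioo (0 : ℝ) 1)
    (w : List (Fin N)) :
    IsHomothety δ (w.map r).prod (wordMap (rotationFreeIFS δ q r) w) := by
  induction w with
  | nil => exact .id hδ
  | cons i w ih =>
    rw [List.map_cons, List.prod_cons]
    exact (isHomothety_rotationFreeIFS hr i).comp hδ ih

theorem prod_map_ratio_le_one (hr : ∀ i, r i ∈ Set.Ioo (0 : ℝ) 1) (w : List (Fin N)) :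
    (w.map r).prod ≤ 1 := by
  induction w with
  | nil => simp
  | cons i w ih =>
    rw [List.map_cons, List.prod_cons]
    have h0 := (hr i).1.le
    have h1 := (hr i).2.le
    nlinarith

theorem prod_map_ratio_lt_one (hr : ∀ i, r i ∈ Set.Ioo (0 : ℝ) 1) {w : List (Fin N)}
    (hw : w ≠ []) : (w.map r).prod < 1 := by
  cases w with
  | nil => exact absurd rfl hw
  | cons i w =>
    rw [List.map_cons, List.prod_cons]
    have h0 := (hr i).1
    have h1 := (hr i).2
    have := prod_map_ratio_le_one hr w
    nlinarith

variable [IsIsometricSMul G G]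

/-- A point of `C` farthest from `O` is some `S i y` with `y ∈ C`, and `S i` contracts the distance
to `O`; so the maximal distance is zero. -/
theorem IsSelfSimilarSet.subset_closure (hδ : IsDilationFamily δ)
    (hr : ∀ i, r i ∈ Set.Ioo (0 : ℝ) 1) (hC : IsSelfSimilarSet (rotationFreeIFS δ q r) C)
    (hO : IsOSCSet (rotationFreeIFS δ q r) O) : C ⊆ closure O := by
  obtain ⟨x, hx, hmax⟩ := hC.isCompact.exists_isMaxOn hC.nonempty
    (continuous_infDist_pt O).continuousOn
  have hcontr : infDist x O ≤ 0 := by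
    obtain ⟨i, y, hy, rfl⟩ := hC.exists_eq hx
    have h1 : infDist (rotationFreeIFS δ q r i y) O ≤ r i * infDist y O := by
      rw [← div_le_iff₀' (hr i).1, le_infDist hO.nonempty]
      intro z hz
      rw [div_le_iff₀' (hr i).1, ← (isHomothety_rotationFreeIFS hr i).dist_map hδ]
      exact infDist_le_dist_of_mem (hO.image_subset i ⟨z, hz, rfl⟩)
    have h2 : infDist y O ≤ infDist (rotationFreeIFS δ q r i y) O := hmax hy
    have h3 := (hr i).1
    have h4 := (hr i).2
    have h5 := infDist_nonneg (x := y) (s := O)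
    nlinarith
  intro y hy
  rw [mem_closure_iff_infDist_zero hO.nonempty]
  exact le_antisymm ((show infDist y O ≤ infDist x O from hmax hy).trans hcontr) infDist_nonneg

/-- A cylinder other than the `i`-th cannot enter `S i '' O`: it lies in the closure of `S j '' O`,
and an open set disjoint from a set is disjoint from its closure. -/
theorem IsSelfSimilarSet.inter_wordMap_image_subset (hδ : IsDilationFamily δ)
    (hr : ∀ i, r i ∈ Set.Ioo (0 : ℝ) 1) (hC : IsSelfSimilarSet (rotationFreeIFS δ q r) C)
    (hO : IsOSCSet (rotationFreeIFS δ q r) O) (v : List (Fin N)) :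
    C ∩ wordMap (rotationFreeIFS δ q r) v '' O ⊆ wordMap (rotationFreeIFS δ q r) v '' C := by
  induction v with
  | nil => simp [wordMap]
  | cons i v ih =>
    rw [wordMap, Set.image_comp, Set.image_comp]
    rintro _ ⟨hx, y, hy, rfl⟩
    have hi := isHomothety_rotationFreeIFS (δ := δ) (q := q) hr i
    obtain ⟨j, z, hz, hzy⟩ := hC.exists_eq hx
    obtain rfl | hij := eq_or_ne i j
    · obtain rfl := (hi.bijective hδ).1 hzy
      exact ⟨z, ih ⟨hz, hy⟩, rfl⟩
    · have hmem : rotationFreeIFS δ q r j z ∈ closure (rotationFreeIFS δ q r j '' O) :=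
        image_closure_subset_closure_image
          ((isHomothety_rotationFreeIFS hr j).lipschitzWith hδ).continuous
          ⟨z, hC.subset_closure hδ hr hO hz, rfl⟩
      exact absurd ⟨y, hO.wordMap_image_subset v hy, hzy.symm⟩
        (((hO.disjoint i j hij).closure_right (hi.isOpen_image hδ hO.isOpen)).notMem_of_mem_right
          hmem)

variable [MeasurableSpace G] [BorelSpace G] {s : ℝ}

/-- Removing the cylinder of `u` leaves first-level pieces plus a remainder inside one piece; as the
weights `r i ^ s` sum to `1`, the total loses `(u.map r).prod ^ s`. Only subadditivity and `E ⊆ ⋃ i,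
S i '' E` enter, so no separation is needed. The sum form avoids truncated subtraction. -/
theorem hausdorffMeasure_diff_wordMap_image_add_le (hδ : IsDilationFamily δ)
    (hr : ∀ i, r i ∈ Set.Ioo (0 : ℝ) 1) (hs0 : 0 ≤ s) (hs : ∑ i, r i ^ s = 1) {E : Set G}
    (hE : E ⊆ ⋃ i, rotationFreeIFS δ q r i '' E) (u : List (Fin N)) :
    μH[s] (E \ wordMap (rotationFreeIFS δ q r) u '' E)
      + ENNReal.ofReal ((u.map r).prod ^ s) * μH[s] E ≤ μH[s] E := by
  set S := rotationFreeIFS δ q r with hS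
  induction u with
  | nil => simp [wordMap]
  | cons i u ih =>
    have hi : IsHomothety δ (r i) (S i) := isHomothety_rotationFreeIFS hr i
    have hu := isHomothety_wordMap (q := q) hδ hr u
    have hsub : E \ wordMap S (i :: u) '' E ⊆
        S i '' (E \ wordMap S u '' E) ∪ ⋃ j ∈ Finset.univ.erase i, S j '' E := by
      rintro x ⟨hx, hxu⟩
      obtain ⟨j, y, hy, rfl⟩ := Set.mem_iUnion.1 (hE hx)
      obtain rfl | hij := eq_or_ne j i
      · refine .inl ⟨y, ⟨hy, fun hyu => hxu ?_⟩, rfl⟩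
        rw [wordMap, Set.image_comp]
        exact ⟨y, hyu, rfl⟩
      · exact .inr (Set.mem_iUnion₂.2 ⟨j, by simpa using hij, y, hy, rfl⟩)
    have hsum : ∑ j, ENNReal.ofReal (r j ^ s) = 1 := by
      rw [← ENNReal.ofReal_sum_of_nonneg fun j _ => Real.rpow_nonneg (hr j).1.le s, hs,
        ENNReal.ofReal_one]
    calc μH[s] (E \ wordMap S (i :: u) '' E)
          + ENNReal.ofReal (((i :: u).map r).prod ^ s) * μH[s] E
        ≤ (μH[s] (S i '' (E \ wordMap S u '' E))
            + ∑ j ∈ Finset.univ.erase i, μH[s] (S j '' E))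
          + ENNReal.ofReal (((i :: u).map r).prod ^ s) * μH[s] E := by
          gcongr
          refine (measure_mono hsub).trans ((measure_union_le _ _).trans ?_)
          gcongr
          exact measure_biUnion_finset_le _ _
      _ = ENNReal.ofReal (r i ^ s) * (μH[s] (E \ wordMap S u '' E)
            + ENNReal.ofReal ((u.map r).prod ^ s) * μH[s] E)
          + ∑ j ∈ Finset.univ.erase i, ENNReal.ofReal (r j ^ s) * μH[s] E := by
          rw [hi.hausdorffMeasure_image hδ hs0, List.map_cons, List.prod_cons,
            Real.mul_rpow (hr i).1.le hu.pos.le,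
            ENNReal.ofReal_mul (Real.rpow_nonneg (hr i).1.le s)]
          simp_rw [hS, (isHomothety_rotationFreeIFS (q := q) hr _).hausdorffMeasure_image hδ hs0]
          ring
      _ ≤ ENNReal.ofReal (r i ^ s) * μH[s] E
          + ∑ j ∈ Finset.univ.erase i, ENNReal.ofReal (r j ^ s) * μH[s] E := by gcongr
      _ = μH[s] E := by
          rw [Finset.add_sum_erase _ (fun j => ENNReal.ofReal (r j ^ s) * μH[s] E)
            (Finset.mem_univ i), ← Finset.sum_mul, hsum, one_mul]

/-- The exceptional set `E` satisfies `E ⊆ ⋃ i, S i '' E` and misses the cylinder of `u`. Removing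
that cylinder thus costs `E` nothing, yet must lower its finite measure by a positive fraction. -/
theorem hausdorffMeasure_diff_iUnion_wordMap_image (hδ : IsDilationFamily δ)
    (hr : ∀ i, r i ∈ Set.Ioo (0 : ℝ) 1) (hC : IsSelfSimilarSet (rotationFreeIFS δ q r) C)
    (hs0 : 0 ≤ s) (hs : ∑ i, r i ^ s = 1) (hfin : μH[s] C ≠ ⊤) (u : List (Fin N)) :
    μH[s] (C \ ⋃ v, wordMap (rotationFreeIFS δ q r) v ''
      (wordMap (rotationFreeIFS δ q r) u '' C)) = 0 := by
  set S := rotationFreeIFS δ q r with hS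
  set E := C \ ⋃ v, wordMap S v '' (wordMap S u '' C) with hEdef
  have hE : E ⊆ ⋃ i, S i '' E := by
    rintro x ⟨hx, hxu⟩
    obtain ⟨i, y, hy, rfl⟩ := hC.exists_eq hx
    refine Set.mem_iUnion.2 ⟨i, y, ⟨hy, fun hyu => hxu ?_⟩, rfl⟩
    obtain ⟨v, z, hz, rfl⟩ := Set.mem_iUnion.1 hyu
    exact Set.mem_iUnion.2 ⟨i :: v, z, hz, rfl⟩
  have hdisj : E \ wordMap S u '' E = E := by
    refine sdiff_eq_left.2 (Set.disjoint_left.2 fun x hx hxu => hx.2 ?_)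
    exact Set.mem_iUnion.2 ⟨[], x, Set.image_mono Set.sdiff_subset hxu, rfl⟩
  have key := hausdorffMeasure_diff_wordMap_image_add_le hδ hr hs0 hs hE u
  rw [← hS, hdisj] at key
  have hEfin : μH[s] E ≠ ⊤ := measure_ne_top_of_subset Set.sdiff_subset hfin
  have hzero : ENNReal.ofReal ((u.map r).prod ^ s) * μH[s] E = 0 := by
    refine le_zero_iff.1 ((ENNReal.add_le_add_iff_left hEfin).1 (key.trans ?_))
    rw [add_zero]
  refine (mul_eq_zero.1 hzero).resolve_left (ENNReal.ofReal_pos.2 ?_).ne'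
  exact Real.rpow_pos_of_pos (isHomothety_wordMap (q := q) hδ hr u).pos s

end SelfSimilar

/-! ### Truncations near periodic points. -/

theorem truncatedSI_one {G : Type*} [MetricSpace G] [MeasurableSpace G] (μ : Measure G)
    (k : G → G → ℝ) (ε : ℝ) (x : G) :
    truncatedSI μ k ε (fun _ => 1) x = ∫ y in (closedBall x ε)ᶜ, k x y ∂μ := by
  simp [truncatedSI]

theorem ofReal_abs_truncatedSI_sub_le {G : Type*} [MetricSpace G] [MeasurableSpace G]
    (μ : Measure G) (k : G → G → ℝ) (f : G → ℝ) (x : G) {ε η : ℝ} (hε : 0 < ε) (hη : 0 < η) :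
    ENNReal.ofReal |truncatedSI μ k ε f x - truncatedSI μ k η f x| ≤ 2 * maximalSI μ k f x := by
  calc ENNReal.ofReal |truncatedSI μ k ε f x - truncatedSI μ k η f x|
      ≤ ENNReal.ofReal (|truncatedSI μ k ε f x| + |truncatedSI μ k η f x|) :=
        ENNReal.ofReal_le_ofReal (abs_sub _ _)
    _ = ENNReal.ofReal |truncatedSI μ k ε f x| + ENNReal.ofReal |truncatedSI μ k η f x| :=
        ENNReal.ofReal_add (abs_nonneg _) (abs_nonneg _)
    _ ≤ maximalSI μ k f x + maximalSI μ k f x :=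
        add_le_add (le_iSup₂ (f := fun ε (_ : 0 < ε) => ENNReal.ofReal |truncatedSI μ k ε f x|) ε hε)
          (le_iSup₂ (f := fun ε (_ : 0 < ε) => ENNReal.ofReal |truncatedSI μ k ε f x|) η hη)
    _ = 2 * maximalSI μ k f x := (two_mul _).symm

theorem setIntegral_normalizedHausdorff_inter {G : Type*} [MetricSpace G] [MeasurableSpace G]
    [BorelSpace G] {s : ℝ} {C : Set G} (hC : MeasurableSet C) (A : Set G) (h : G → ℝ) :
    ∫ y in A, h y ∂normalizedHausdorff s C = ∫ y in C ∩ A, h y ∂normalizedHausdorff s C := by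
  refine setIntegral_congr_set ?_
  filter_upwards [ae_mem_normalizedHausdorff (s := s) hC] with y hy
  exact propext ⟨fun h => ⟨hy, h⟩, fun h => h.2⟩

section SelfSimilar

variable {G : Type*} [MetricSpace G] [Group G] [IsIsometricSMul G G] {δ : ℝ → G →* G} {N : ℕ}
  {q : Fin N → G} {r : Fin N → ℝ} {C O : Set G} {x₀ x : G} {c : ℝ}

theorem closedBall_wordMap_inter_subset (hδ : IsDilationFamily δ)
    (hr : ∀ i, r i ∈ Set.Ioo (0 : ℝ) 1) (hC : IsSelfSimilarSet (rotationFreeIFS δ q r) C)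
    (hO : IsOSCSet (rotationFreeIFS δ q r) O) (hx : closedBall x c ⊆ O) (v : List (Fin N)) :
    C ∩ closedBall (wordMap (rotationFreeIFS δ q r) v x) ((v.map r).prod * c) ⊆
      wordMap (rotationFreeIFS δ q r) v '' (C ∩ closedBall x c) := by
  have hv := isHomothety_wordMap (q := q) hδ hr v
  rintro y ⟨hyC, hy⟩
  rw [← hv.image_closedBall hδ] at hy
  obtain ⟨z, hz, rfl⟩ := hy
  obtain ⟨z', hz', h⟩ := hC.inter_wordMap_image_subset hδ hr hO v ⟨hyC, z, hx hz, rfl⟩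
  obtain rfl := (hv.bijective hδ).1 h
  exact ⟨z', ⟨hz', hz⟩, rfl⟩

/-- Every periodic point is the intersection of a decreasing sequence of cylinders. -/
theorem exists_wordMap_image_subset_ball (hδ : IsDilationFamily δ)
    (hr : ∀ i, r i ∈ Set.Ioo (0 : ℝ) 1) (hC : IsSelfSimilarSet (rotationFreeIFS δ q r) C)
    {w : List (Fin N)} (hw : w ≠ []) (hx₀ : wordMap (rotationFreeIFS δ q r) w x₀ = x₀)
    {η : ℝ} (hη : 0 < η) :
    ∃ u, wordMap (rotationFreeIFS δ q r) u '' C ⊆ ball x₀ η := by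
  have hpow : ∀ m : ℕ, ∃ u, wordMap (rotationFreeIFS δ q r) u x₀ = x₀ ∧
      (u.map r).prod = (w.map r).prod ^ m := by
    intro m
    induction m with
    | zero => exact ⟨[], rfl, by simp⟩
    | succ m ih =>
      obtain ⟨u, hu, hum⟩ := ih
      exact ⟨w ++ u, by rw [wordMap_append, Function.comp_apply, hu, hx₀],
        by rw [List.map_append, List.prod_append, hum, pow_succ']⟩
  obtain ⟨D, hD⟩ := hC.isCompact.isBounded.subset_ball x₀
  have hD' : (0 : ℝ) < max D 1 := by positivity
  obtain ⟨m, hm⟩ := exists_pow_lt_of_lt_one (div_pos hη hD') (prod_map_ratio_lt_one hr hw)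
  obtain ⟨u, hu, hum⟩ := hpow m
  have hhom := isHomothety_wordMap (q := q) hδ hr u
  refine ⟨u, ?_⟩
  rintro _ ⟨y, hy, rfl⟩
  rw [mem_ball, ← hu, hhom.dist_map hδ, hum]
  rw [lt_div_iff₀ hD'] at hm
  refine lt_of_le_of_lt (mul_le_mul_of_nonneg_left ?_ ?_) hm
  · exact (mem_ball.1 (hD hy)).le.trans (le_max_left _ _)
  · exact hum ▸ hhom.pos.le

/-- Keeps the singularity of `k x` away from the domain of integration. -/
theorem le_dist_of_mem_diff_wordMap_image (hδ : IsDilationFamily δ)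
    (hr : ∀ i, r i ∈ Set.Ioo (0 : ℝ) 1) (hC : IsSelfSimilarSet (rotationFreeIFS δ q r) C)
    (hO : IsOSCSet (rotationFreeIFS δ q r) O) (hx : closedBall x c ⊆ O) {v : List (Fin N)}
    (hv : wordMap (rotationFreeIFS δ q r) v x = x) :
    ∀ y ∈ C \ wordMap (rotationFreeIFS δ q r) v '' C, (v.map r).prod * c ≤ dist x y := by
  rintro y ⟨hyC, hy⟩
  by_contra! hlt
  have := closedBall_wordMap_inter_subset hδ hr hC hO hx v
    ⟨hyC, by rw [hv, mem_closedBall']; exact hlt.le⟩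
  exact hy (Set.image_mono Set.inter_subset_left this)

variable [MeasurableSpace G] [BorelSpace G] {s M : ℝ} {k : G → G → ℝ}

theorem IsSelfSimilarSet.measurableSet_wordMap_image (hδ : IsDilationFamily δ)
    (hr : ∀ i, r i ∈ Set.Ioo (0 : ℝ) 1) (hC : IsSelfSimilarSet (rotationFreeIFS δ q r) C)
    (v : List (Fin N)) : MeasurableSet (wordMap (rotationFreeIFS δ q r) v '' C) :=
  (hC.isCompact.image
    ((isHomothety_wordMap (q := q) hδ hr v).lipschitzWith hδ).continuous).measurableSet

theorem IsHomogeneousKernel.setIntegral_image (hδ : IsDilationFamily δ)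
    (hk : IsHomogeneousKernel δ s k) (hs : 0 ≤ s) {ρ : ℝ} {f : G → G} (hf : IsHomothety δ ρ f)
    {B : Set G} (hB : MeasurableSet B) (hBC : B ⊆ C) (hfB : f '' B ⊆ C) (hxB : x ∉ B) :
    ∫ y in f '' B, k (f x) y ∂normalizedHausdorff s C
      = ∫ y in B, k x y ∂normalizedHausdorff s C := by
  rw [hf.setIntegral_image hδ hs _ hBC hfB, ← integral_const_mul]
  exact setIntegral_congr_fun hB fun y hy => hk.map hδ hf fun h => hxB (h ▸ hy)

variable [IsTopologicalGroup G]

/-- The kernel integral off a periodic cylinder is additive under iteration of the period. -/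
theorem exists_setIntegral_diff_eq_nat_mul (hδ : IsDilationFamily δ)
    (hr : ∀ i, r i ∈ Set.Ioo (0 : ℝ) 1) (hC : IsSelfSimilarSet (rotationFreeIFS δ q r) C)
    (hO : IsOSCSet (rotationFreeIFS δ q r) O) (hx₀ : x₀ ∈ C) (hx₀O : x₀ ∈ O)
    {w : List (Fin N)} (hw : wordMap (rotationFreeIFS δ q r) w x₀ = x₀)
    (hk : IsHomogeneousKernel δ s k) (hs : 0 ≤ s) (hM : 0 ≤ M)
    (hkM : ∀ x y, x ≠ y → |k x y| ≤ M / dist x y ^ s) (m : ℕ) :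
    ∃ W, wordMap (rotationFreeIFS δ q r) W x₀ = x₀ ∧
      ∫ y in C \ wordMap (rotationFreeIFS δ q r) W '' C, k x₀ y ∂normalizedHausdorff s C
        = m * ∫ y in C \ wordMap (rotationFreeIFS δ q r) w '' C, k x₀ y
          ∂normalizedHausdorff s C := by
  obtain ⟨c, hc, hcO⟩ := nhds_basis_closedBall.mem_iff.1 (hO.isOpen.mem_nhds hx₀O)
  set S := rotationFreeIFS δ q r with hS
  have hmeas : ∀ v, MeasurableSet (C \ wordMap S v '' C) := fun v =>
    hC.isCompact.measurableSet.diff (hC.measurableSet_wordMap_image hδ hr v)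
  have hhom : ∀ v, IsHomothety δ (v.map r).prod (wordMap S v) := isHomothety_wordMap hδ hr
  have hint : ∀ v, wordMap S v x₀ = x₀ →
      IntegrableOn (k x₀) (C \ wordMap S v '' C) (normalizedHausdorff s C) := fun v hv =>
    hk.integrableOn hs hM hkM (mul_pos (hhom v).pos hc) (hmeas v)
      (le_dist_of_mem_diff_wordMap_image hδ hr hC hO hcO hv)
  induction m with
  | zero => exact ⟨[], rfl, by simp [wordMap]⟩
  | succ m ih =>
    obtain ⟨W, hW, hWm⟩ := ih
    have hwW : wordMap S (w ++ W) x₀ = x₀ := by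
      rw [wordMap_append, Function.comp_apply, hW, hw]
    refine ⟨w ++ W, hwW, ?_⟩
    -- The second piece is the `S_w`-image of the previous domain; since `S_w` fixes `x₀`, it
    -- contributes the previous integral unchanged.
    have hdecomp : C \ wordMap S (w ++ W) '' C
        = (C \ wordMap S w '' C) ∪ wordMap S w '' (C \ wordMap S W '' C) := by
      rw [wordMap_append, Set.image_comp, Set.image_sdiff ((hhom w).bijective hδ).1,
        Set.sdiff_union_sdiff_cancel (hC.wordMap_image_subset w)
          (Set.image_mono (hC.wordMap_image_subset W))]
    have hdisj : Disjoint (C \ wordMap S w '' C) (wordMap S w '' (C \ wordMap S W '' C)) :=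
      Set.disjoint_left.2 fun y hy hy' => hy.2 (Set.image_mono Set.sdiff_subset hy')
    have hsub : wordMap S w '' (C \ wordMap S W '' C) ⊆ C :=
      (Set.image_mono Set.sdiff_subset).trans (hC.wordMap_image_subset w)
    have hscale := hk.setIntegral_image hδ hs (hhom w) (hmeas W) Set.sdiff_subset hsub
      fun h => h.2 ⟨x₀, hx₀, hW⟩
    rw [hw] at hscale
    have hintW := hint _ hwW
    rw [hdecomp] at hintW ⊢
    rw [setIntegral_union hdisj
      ((hhom w).measurableEmbedding hδ |>.measurableSet_image.2 (hmeas W))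
      (hintW.mono_set Set.subset_union_left) (hintW.mono_set Set.subset_union_right), hscale, hWm]
    push_cast
    ring

/-- Near a periodic point, differences of truncations at cylinder scales see the full kernel
integral off the periodic cylinder, up to a fixed error. -/
theorem abs_setIntegral_diff_le_truncatedSI (hδ : IsDilationFamily δ)
    (hr : ∀ i, r i ∈ Set.Ioo (0 : ℝ) 1) (hC : IsSelfSimilarSet (rotationFreeIFS δ q r) C)
    (hO : IsOSCSet (rotationFreeIFS δ q r) O) (hc : 0 < c) (hcO : closedBall x₀ (2 * c) ⊆ O)
    {W : List (Fin N)} (hW : wordMap (rotationFreeIFS δ q r) W x₀ = x₀)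
    (hk : IsHomogeneousKernel δ s k) (hs : 0 ≤ s) (hM : 0 ≤ M)
    (hkM : ∀ x y, x ≠ y → |k x y| ≤ M / dist x y ^ s)
    (hx : dist x x₀ ≤ (W.map r).prod * c) (v : List (Fin N)) :
    |∫ y in C \ wordMap (rotationFreeIFS δ q r) W '' C, k x y ∂normalizedHausdorff s C| ≤
      |truncatedSI (normalizedHausdorff s C) k ((v.map r).prod * ((W.map r).prod * c))
            (fun _ => 1) (wordMap (rotationFreeIFS δ q r) v x)
          - truncatedSI (normalizedHausdorff s C) k ((v.map r).prod * c)
            (fun _ => 1) (wordMap (rotationFreeIFS δ q r) v x)|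
        + 2 * (M / c ^ s * (normalizedHausdorff s C).real C) := by
  set S := rotationFreeIFS δ q r with hS
  set μ := normalizedHausdorff s C with hμ
  have hv : IsHomothety δ (v.map r).prod (wordMap S v) := isHomothety_wordMap hδ hr v
  have hWh : IsHomothety δ (W.map r).prod (wordMap S W) := isHomothety_wordMap hδ hr W
  have hW1 : (W.map r).prod ≤ 1 := prod_map_ratio_le_one hr W
  set R := (v.map r).prod
  set ρ := (W.map r).prod
  have hR := hv.pos
  have hρ := hWh.pos
  have hρc : ρ * c ≤ c := by nlinarith
  have hCm : MeasurableSet C := hC.isCompact.measurableSet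
  have hcm : ∀ (z : G) (t : ℝ), MeasurableSet (closedBall z t) := fun _ _ => measurableSet_closedBall
  have hWm : MeasurableSet (wordMap S W '' C) := hC.measurableSet_wordMap_image hδ hr W
  have hWC : wordMap S W '' C ⊆ C := hC.wordMap_image_subset W
  have hxO : closedBall x c ⊆ O :=
    (closedBall_subset_closedBall' (by linarith)).trans hcO
  have hfar : ∀ {z y : G} {t : ℝ}, y ∉ closedBall z t → t ≤ dist z y := fun h =>
    (not_le.1 (mt mem_closedBall'.2 h)).le
  -- the difference of truncations at `S_v x`, rescaled to `x`
  have htrunc : truncatedSI μ k (R * (ρ * c)) (fun _ => 1) (wordMap S v x)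
      - truncatedSI μ k (R * c) (fun _ => 1) (wordMap S v x)
      = ∫ y in C ∩ (closedBall x c \ closedBall x (ρ * c)), k x y ∂μ := by
    have hset : C ∩ (closedBall (wordMap S v x) (R * c) \ closedBall (wordMap S v x) (R * (ρ * c)))
        = wordMap S v '' (C ∩ (closedBall x c \ closedBall x (ρ * c))) := by
      ext y
      constructor
      · rintro ⟨hyC, hy, hy'⟩
        obtain ⟨z, ⟨hzC, hz⟩, rfl⟩ := closedBall_wordMap_inter_subset hδ hr hC hO hxO v ⟨hyC, hy⟩
        exact ⟨z, ⟨hzC, hz, fun h => hy' ((hv.map_mem_closedBall hδ).2 h)⟩, rfl⟩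
      · rintro ⟨z, ⟨hzC, hz, hz'⟩, rfl⟩
        exact ⟨hC.wordMap_image_subset v ⟨z, hzC, rfl⟩, (hv.map_mem_closedBall hδ).2 hz,
          fun h => hz' ((hv.map_mem_closedBall hδ).1 h)⟩
    have hsub : (closedBall (wordMap S v x) (R * c))ᶜ
        ⊆ (closedBall (wordMap S v x) (R * (ρ * c)))ᶜ :=
      Set.compl_subset_compl.2 (closedBall_subset_closedBall (by gcongr))
    rw [truncatedSI_one, truncatedSI_one, ← setIntegral_sdiff (hcm _ _).compl
      (hk.integrableOn hs hM hkM (by positivity) (hcm _ _).compl fun y hy => hfar hy) hsub,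
      compl_sdiff_compl, hμ, setIntegral_normalizedHausdorff_inter hCm, hset]
    refine hk.setIntegral_image hδ hs hv (hCm.inter ((hcm _ _).diff (hcm _ _)))
      Set.inter_subset_left ?_ fun h => h.2.2 (mem_closedBall_self (by positivity))
    exact (Set.image_mono Set.inter_subset_left).trans (hC.wordMap_image_subset v)
  -- The ball lies within `2 * (ρ * c)` of `x₀ = S_W x₀`; this is why `O` must contain the ball of
  -- radius `2 * c`.
  have hball : C ∩ closedBall x (ρ * c) ⊆ wordMap S W '' C := by
    rintro y ⟨hyC, hy⟩
    have hy' : y ∈ closedBall (wordMap S W x₀) (ρ * (2 * c)) := by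
      rw [hW, mem_closedBall]
      rw [mem_closedBall] at hy
      linarith [dist_triangle y x x₀]
    exact Set.image_mono Set.inter_subset_left
      (closedBall_wordMap_inter_subset hδ hr hC hO hcO W ⟨hyC, hy'⟩)
  have hint : IntegrableOn (k x) (C \ closedBall x (ρ * c)) μ :=
    hk.integrableOn hs hM hkM (by positivity) (hCm.diff (hcm _ _)) fun y hy => hfar hy.2
  have h1 : ∫ y in C ∩ (closedBall x c \ closedBall x (ρ * c)), k x y ∂μ
      = ∫ y in C \ closedBall x (ρ * c), k x y ∂μ - ∫ y in C \ closedBall x c, k x y ∂μ := by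
    rw [← setIntegral_sdiff (hCm.diff (hcm _ _)) hint
      (Set.sdiff_subset_sdiff_right (closedBall_subset_closedBall hρc))]
    congr 2
    ext y
    simp only [Set.mem_inter_iff, Set.mem_sdiff]
    tauto
  have h2 : ∫ y in C \ wordMap S W '' C, k x y ∂μ
      = ∫ y in C \ closedBall x (ρ * c), k x y ∂μ
        - ∫ y in wordMap S W '' C \ closedBall x (ρ * c), k x y ∂μ := by
    rw [← setIntegral_sdiff (hWm.diff (hcm _ _)) hint (Set.sdiff_subset_sdiff_left hWC)]
    congr 2
    ext y
    have := @hball y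
    simp only [Set.mem_inter_iff, Set.mem_sdiff] at this ⊢
    tauto
  have h3 : |∫ y in C \ closedBall x c, k x y ∂μ| ≤ M / c ^ s * μ.real C := by
    refine (abs_setIntegral_kernel_le hs hM hkM hc fun y hy => hfar hy.2).trans ?_
    gcongr
    exacts [measure_ne_top _ _, Set.sdiff_subset]
  -- The kernel bound `M / (ρ * c) ^ s` is offset by the mass `ρ ^ s * μ.real C` of the cylinder, so
  -- the error does not depend on `W`.
  have h4 : |∫ y in wordMap S W '' C \ closedBall x (ρ * c), k x y ∂μ|
      ≤ M / c ^ s * μ.real C := by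
    refine (abs_setIntegral_kernel_le hs hM hkM (mul_pos hρ hc) fun y hy => hfar hy.2).trans ?_
    calc M / (ρ * c) ^ s * μ.real (wordMap S W '' C \ closedBall x (ρ * c))
        ≤ M / (ρ * c) ^ s * μ.real (wordMap S W '' C) := by
          gcongr
          exacts [measure_ne_top _ _, Set.sdiff_subset]
      _ = M / c ^ s * μ.real C := by
          rw [hWh.normalizedHausdorff_image hδ hs subset_rfl hWC, ← hμ,
            Real.mul_rpow hρ.le hc.le]
          field_simp
  rw [htrunc, h1, h2]
  set a := ∫ y in C \ closedBall x (ρ * c), k x y ∂μ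
  set b := ∫ y in C \ closedBall x c, k x y ∂μ
  set d := ∫ y in wordMap S W '' C \ closedBall x (ρ * c), k x y ∂μ
  calc |a - d| = |(a - b) + (b - d)| := by ring_nf
    _ ≤ |a - b| + (|b| + |d|) := (abs_add_le _ _).trans (by gcongr; exact abs_sub _ _)
    _ ≤ _ := by linarith

end SelfSimilar

/-! ### The main theorem. -/

theorem mainTheorem4 {G : Type*} [MetricSpace G] [Group G] [IsTopologicalGroup G]
    [IsIsometricSMul G G] [CompleteSpace G] [MeasurableSpace G] [BorelSpace G]
    (hG : IsDoublingMetric G)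
    (δ : ℝ → G →* G) (hδ : IsDilationFamily δ)
    (N : ℕ) (hN : 2 ≤ N) (q : Fin N → G) (r : Fin N → ℝ)
    (hr : ∀ i, r i ∈ Set.Ioo (0 : ℝ) 1)
    (hOSC : SatisfiesOSC (rotationFreeIFS δ q r))
    (C : Set G) (hC : IsSelfSimilarSet (rotationFreeIFS δ q r) C)
    (s : ℝ) (hs : ∑ i, r i ^ s = 1)
    (k : G → G → ℝ) (hk : IsHomogeneousKernel δ s k)
    (w : List (Fin N)) (x_w : G) (hx : IsPeriodicPoint (rotationFreeIFS δ q r) C w x_w)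
    (O : Set G) (hO : IsSOSCSet (rotationFreeIFS δ q r) C O) (hxO : x_w ∈ O)
    (hint : ∫ y in C \ (wordMap (rotationFreeIFS δ q r) w '' C), k x_w y
      ∂(normalizedHausdorff s C) ≠ 0) :
    ∀ᵐ x ∂(normalizedHausdorff s C),
      maximalSI (normalizedHausdorff s C) k (fun _ => 1) x = ⊤ := by
  have hs0 : 0 ≤ s := by
    by_contra! hneg
    have h1 : ∑ _i : Fin N, (1 : ℝ) ≤ ∑ i, r i ^ s := Finset.sum_le_sum fun i _ =>
      Real.one_le_rpow_of_pos_of_le_one_of_nonpos (hr i).1 (hr i).2.le hneg.le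
    have h2 : (2 : ℝ) ≤ N := by exact_mod_cast hN
    rw [hs, Finset.sum_const, Finset.card_univ, Fintype.card_fin, nsmul_eq_mul, mul_one] at h1
    linarith
  have hw : w ≠ [] := by
    rintro rfl
    simp [wordMap] at hint
  -- Infinite measure would make the normalized measure zero, and with it the integral in `hint`.
  have hfin : μH[s] C ≠ ⊤ := by
    intro htop
    simp [normalizedHausdorff, htop] at hint
  obtain ⟨M, hM, hkM⟩ := hk.exists_bound hG hδ
  obtain ⟨c, hc, hcO⟩ : ∃ c : ℝ, 0 < c ∧ closedBall x_w (2 * c) ⊆ O := by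
    obtain ⟨c, hc, hcO⟩ := nhds_basis_closedBall.mem_iff.1 (hO.1.isOpen.mem_nhds hxO)
    exact ⟨c / 2, half_pos hc, by rwa [mul_div_cancel₀ c two_ne_zero]⟩
  set S := rotationFreeIFS δ q r with hS
  set μ := normalizedHausdorff s C with hμ
  set I := ∫ y in C \ (wordMap S w '' C), k x_w y ∂μ with hI
  set B := 2 * (M / c ^ s * μ.real C)
  have key : ∀ m : ℕ, ∀ᵐ x ∂μ,
      ENNReal.ofReal (m * |I| - 1 - B) ≤ 2 * maximalSI μ k (fun _ => 1) x := by
    intro m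
    obtain ⟨W, hW, hWm⟩ :=
      exists_setIntegral_diff_eq_nat_mul hδ hr hC hO.1 hx.1 hxO hx.2 hk hs0 hM hkM m
    have hWh : IsHomothety δ (W.map r).prod (wordMap S W) := isHomothety_wordMap hδ hr W
    have hcont : ContinuousAt (fun x => ∫ y in C \ wordMap S W '' C, k x y ∂μ) x_w :=
      hk.continuousAt_setIntegral hs0 hM hkM (mul_pos hWh.pos (by positivity : 0 < 2 * c))
        (hC.isCompact.measurableSet.diff (hC.measurableSet_wordMap_image hδ hr W))
        (le_dist_of_mem_diff_wordMap_image hδ hr hC hO.1 hcO hW)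
    obtain ⟨η, hη, hηI⟩ := Metric.continuousAt_iff.1 hcont 1 one_pos
    -- The radius `η` keeps the integral within `1` of `m * I`; the radius `(W.map r).prod * c`
    -- permits the comparison with truncations.
    obtain ⟨u, hu⟩ := exists_wordMap_image_subset_ball hδ hr hC hw hx.2
      (lt_min hη (mul_pos hWh.pos hc))
    have hnull := hausdorffMeasure_diff_iUnion_wordMap_image hδ hr hC hs0 hs hfin u
    have hae : ∀ᵐ x ∂μ, x ∈ ⋃ v, wordMap S v '' (wordMap S u '' C) := by
      refine Measure.ae_smul_measure ?_ _
      rw [ae_restrict_iff' hC.isCompact.measurableSet, ae_iff]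
      convert hnull using 2
      ext x
      exact Classical.not_imp
    filter_upwards [hae] with x hxu
    obtain ⟨v, x', hx', rfl⟩ := Set.mem_iUnion.1 hxu
    have hx'd : dist x' x_w < min η ((W.map r).prod * c) := hu hx'
    have hnear := hηI (hx'd.trans_le (min_le_left _ _))
    have hest := abs_setIntegral_diff_le_truncatedSI hδ hr hC hO.1 hc hcO hW hk hs0 hM hkM
      (hx'd.le.trans (min_le_right _ _)) v
    rw [hWm, Real.dist_eq] at hnear
    have hv : IsHomothety δ (v.map r).prod (wordMap S v) := isHomothety_wordMap hδ hr v
    refine le_trans (ENNReal.ofReal_le_ofReal ?_) (ofReal_abs_truncatedSI_sub_le μ k _ _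
      (mul_pos hv.pos (mul_pos hWh.pos hc)) (mul_pos hv.pos hc))
    have habs : (m : ℝ) * |I| = |m * I| := by rw [abs_mul, Nat.abs_cast]
    have htri := abs_sub_abs_le_abs_sub (m * I) (∫ y in C \ wordMap S W '' C, k x' y ∂μ)
    rw [abs_sub_comm (m * I)] at htri
    linarith
  filter_upwards [ae_all_iff.2 key] with x hx
  by_contra hne
  have h2 : 2 * maximalSI μ k (fun _ => 1) x ≠ ⊤ := ENNReal.mul_ne_top ENNReal.ofNat_ne_top hne
  obtain ⟨m, hm⟩ := exists_nat_gt
    (((2 * maximalSI μ k (fun _ => 1) x).toReal + 1 + B) / |I|)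
  rw [div_lt_iff₀ (abs_pos.2 hint)] at hm
  have := (ENNReal.ofReal_le_iff_le_toReal h2).1 (hx m)
  linarith
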